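/- Let $k\ge 1$ and $f(x)=x^k$. For $x\ge 0$ put $\gamma_k(x)=(x,x^k)$, and let $\gamma_k(x)^{\circ k}$ denote this point repeated $k$ times. For points $p_i=(x_i,y_i)$ listed in order of their $x$-coordinates, in which repeated points lie on the graph of $f$, the divided differences with respect to $f$ are defined by $\Delta_0(p_1)=y_1$ and $$\Delta_j(p_1,\dots,p_{j+1})=\frac{\Delta_{j-1}(p_2,\dots,p_{j+1})-\Delta_{j-1}(p_1,\dots,p_j)}{x_{j+1}-x_1}\quad\text{if } x_{j+1}\neq x_1,$$ and $\Delta_j(p^{\circ (j+1)})=f^{(j)}(x)/j!$ for $p=(x,f(x))$. Such a list of points is a $k$-monotone chain if every $(k+1)$-element sublist has $\Delta_k\ge 0$. For $0\le a<b$ let $\Phi_k(a)(x)=x^k-(x-a)^k$ and $\Psi_k(a,b)(x)=x^k-(x-a)^{k-1}(x-b)$, and let $C_k(a,b)$ be the cell of all points $(x,y)$ with $a\le x\le b$ and $$\max\{\Phi_k(a)(x),\Phi_k(b)(x)\}\le y\le\min\{\Psi_k(a,b)(x),\Psi_k(b,a)(x)\}\quad(k\text{ even}),$$ $$\max\{\Phi_k(a)(x),\Psi_k(b,a)(x)\}\le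 y\le\min\{\Psi_k(a,b)(x),\Phi_k(b)(x)\}\quad(k\text{ odd}).$$ Let $\Pi$ be a homogeneous Poisson point process of intensity $1$ in the plane, and let $L^k(a,b)$ be the maximal $m$ for which there are points $p_1,\dots,p_m\in\Pi\cap C_k(a,b)$, with strictly increasing $x$-coordinates in $(a,b)$, such that $(\gamma_k(a)^{\circ k},p_1,\dots,p_m,\gamma_k(b)^{\circ k})$ is a $k$-monotone chain. Then for every integer $k\ge 1$ there is a constant $c_k$, depending only on $k$, such that for every integer $n\ge 1$ the random variable $L^k(0,n)$ satisfies $$\mathbb{E}\,L^k(0,n)<c_k\,n .$$ -/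

import Mathlib

open MeasureTheory ProbabilityTheory
open scoped ENNReal Nat

noncomputable section

namespace KMonotone

/-- The point `γ_k(x) = (x, x ^ k)` of the curve `Γ_k`. -/
def gamma (k : ℕ) (x : ℝ) : ℝ × ℝ := (x, x ^ k)

/-- The `j`-th divided difference, with respect to the function `f`, of a `(j+1)`-tuple of points
listed in order of their `x`-coordinates, where distinct entries have distinct `x`-coordinates and
every repeated point lies on the graph of `f`. If the first and the last `x`-coordinate agree, the
tuple consists of `j+1` copies of one point, and the divided difference is `f^{(j)}(x) / j!`. -/
def divDiff (f : ℝ → ℝ) : (j : ℕ) → (Fin (j + 1) → ℝ × ℝ) → ℝ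
  | 0, p => (p 0).2
  | j + 1, p =>
    if (p (Fin.last (j + 1))).1 = (p 0).1 then
      iteratedDeriv (j + 1) f (p 0).1 / ((j + 1)! : ℝ)
    else
      (divDiff f j (Fin.tail p) - divDiff f j (Fin.init p)) /
        ((p (Fin.last (j + 1))).1 - (p 0).1)

/-- A tuple of points, in order of their `x`-coordinates and possibly with repeated points on the
graph of `f`, is `k`-monotone with respect to `f` if each of its `(k+1)`-element subtuples is
positive, that is, has nonnegative `k`-th divided difference. -/
def IsKMonotone (k : ℕ) (f : ℝ → ℝ) {N : ℕ} (q : Fin N → ℝ × ℝ) : Prop :=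
  ∀ s : Fin (k + 1) ↪o Fin N, 0 ≤ divDiff f k (q ∘ s)

/-- The extended tuple `(γ_k(a)^{∘ k}, p_1, …, p_m, γ_k(b)^{∘ k})`. -/
def extend (k : ℕ) (a b : ℝ) {m : ℕ} (p : Fin m → ℝ × ℝ) : Fin (k + m + k) → ℝ × ℝ :=
  Fin.append (Fin.append (fun _ : Fin k => gamma k a) p) (fun _ : Fin k => gamma k b)

/-- The polynomial `Φ_k(a)(x) = x^k - (x - a)^k`. -/
def Phi (k : ℕ) (a x : ℝ) : ℝ := x ^ k - (x - a) ^ k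

/-- The polynomial `Ψ_k(a,b)(x) = x^k - (x - a)^(k-1) (x - b)`, for `k ≥ 1`. -/
def Psi (k : ℕ) (a b x : ℝ) : ℝ := x ^ k - (x - a) ^ (k - 1) * (x - b)

/-- The lower boundary of the cell: `Φ_k(a)` on the left half of `[a, b]`; on the right half it is
`Φ_k(b)` for even `k` and `Ψ_k(b,a)` for odd `k`. -/
def lowerBoundary (k : ℕ) (a b x : ℝ) : ℝ :=
  max (Phi k a x) (if Even k then Phi k b x else Psi k b a x)

/-- The upper boundary of the cell: `Ψ_k(a,b)` on the left half of `[a, b]`; on the right half it is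
`Ψ_k(b,a)` for even `k` and `Φ_k(b)` for odd `k`. -/
def upperBoundary (k : ℕ) (a b x : ℝ) : ℝ :=
  min (Psi k a b x) (if Even k then Psi k b a x else Phi k b x)

/-- The cell `C_k(a,b)`, bounded by the graphs of `Φ_k(a)`, `Φ_k(b)`, `Ψ_k(a,b)`, `Ψ_k(b,a)` over
`[a, b]`. For `k = 1` it is the square `[a, b]²`. -/
def cell (k : ℕ) (a b : ℝ) : Set (ℝ × ℝ) :=
  {p | a ≤ p.1 ∧ p.1 ≤ b ∧ lowerBoundary k a b p.1 ≤ p.2 ∧ p.2 ≤ upperBoundary k a b p.1}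

/-- `p = (p_1, …, p_m)` is a chain of points of `S ∩ C_k(a,b)` such that
`(γ_k(a)^{∘ k}, p_1, …, p_m, γ_k(b)^{∘ k})` is a `k`-monotone chain (with respect to `x ↦ x^k`).
The points are ordered by strictly increasing `x`-coordinate, strictly between the `x`-coordinates
of `γ_k(a)` and `γ_k(b)`. -/
structure IsMonotoneChain (k : ℕ) (a b : ℝ) (S : Set (ℝ × ℝ)) {m : ℕ}
    (p : Fin m → ℝ × ℝ) : Prop where
  mem : ∀ i, p i ∈ S ∩ cell k a b
  strictMono : StrictMono fun i => (p i).1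
  left_lt : ∀ i, a < (p i).1
  lt_right : ∀ i, (p i).1 < b
  monotone : IsKMonotone k (fun x => x ^ k) (extend k a b p)

/-- The maximal length `L^k(a,b)` of such a chain, for the point set `S`. -/
def maxLength (k : ℕ) (a b : ℝ) (S : Set (ℝ × ℝ)) : ℕ∞ :=
  ⨆ (m : ℕ) (_ : ∃ p : Fin m → ℝ × ℝ, IsMonotoneChain k a b S p), (m : ℕ∞)

/-- `Π` is a homogeneous Poisson point process of intensity `1` in the plane, on the probability
space `(Ω, P)`: a random locally finite set whose number of points in a bounded Borel set `B` is
a Poisson random variable with parameter the area of `B`, the numbers of points in finitely many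
pairwise disjoint bounded Borel sets being independent. -/
structure IsPoissonProcess {Ω : Type*} [MeasurableSpace Ω] (P : Measure Ω)
    (Pi : Ω → Set (ℝ × ℝ)) : Prop where
  locallyFinite : ∀ ω, ∀ B : Set (ℝ × ℝ), Bornology.IsBounded B → (Pi ω ∩ B).Finite
  measurable_count : ∀ B : Set (ℝ × ℝ), MeasurableSet B → Bornology.IsBounded B →
    Measurable fun ω => (Pi ω ∩ B).ncard
  law_count : ∀ B : Set (ℝ × ℝ), MeasurableSet B → Bornology.IsBounded B →
    P.map (fun ω => (Pi ω ∩ B).ncard) = poissonMeasure (volume B).toNNReal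
  indep_count : ∀ (r : ℕ) (B : Fin r → Set (ℝ × ℝ)), (∀ i, MeasurableSet (B i)) →
    (∀ i, Bornology.IsBounded (B i)) → Pairwise (fun i j => Disjoint (B i) (B j)) →
    iIndepFun (fun i ω => (Pi ω ∩ B i).ncard) P

end KMonotone

end

namespace KMonotone

open Filter Topology

/-! The proof is a first-moment argument. The probability that the process contains a chain of
length `m` is at most the volume of the set of all chains of length `m` in `(ℝ²)^m`; chains are
ordered by abscissa, so no factor `m!` is lost
(`IsPoissonProcess.measure_exists_isMonotoneChain_le`).

To bound this volume, write `k = K + 1`, fix the abscissas and look at the divided differences of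
order `K` over windows of consecutive nodes. Monotonicity makes them nondecreasing. They start at `k
a` and end at `k b`, because `f^(K)(x) / K! = k x` at the `k`-fold end points. So their increments
are nonnegative with sum at most `k (b - a)` (`increment_nonneg`, `sum_increment_le`). The map from
ordinates to increments is triangular affine with diagonal entries `1 / gapProd`
(`isLead_increment`), so a fibre has volume at most `∏ gapProd` times that of a simplex. AM-GM
bounds the product, and the increasing abscissas lie in another set of simplex size
(`volume_chainSet_le`).

On `[0, n]` the two simplices give `(C (n/m)²)^m` with `C` depending on `k` only, while the product
of gaps contributes at most a further constant to the power `m`. For `m` above a multiple of `n` the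
volume is thus at most `2^(-m)`, and summing `m 2^(-m)` adds only a constant to the expectation. -/

/-- The index of the cell of the square grid of mesh `1 / (l + 1)` that contains a point. -/
noncomputable def gridIndex (l : ℕ) (p : ℝ × ℝ) : ℤ × ℤ :=
  (⌊((l : ℝ) + 1) * p.1⌋, ⌊((l : ℝ) + 1) * p.2⌋)

lemma measurable_gridIndex (l : ℕ) : Measurable (gridIndex l) := by
  unfold gridIndex
  exact ((measurable_fst.const_mul _).floor).prodMk ((measurable_snd.const_mul _).floor)

lemma abs_sub_le_of_floor_eq {c x y : ℝ} (hc : 0 < c) (h : ⌊c * x⌋ = ⌊c * y⌋) :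
    |x - y| ≤ 1 / c := by
  have h1 := (Int.abs_sub_lt_one_of_floor_eq_floor h).le
  rw [← mul_sub, abs_mul, abs_of_pos hc] at h1
  rw [le_div_iff₀ hc, mul_comm]
  exact h1

lemma dist_le_of_gridIndex_eq {l : ℕ} {p q : ℝ × ℝ} (h : gridIndex l p = gridIndex l q) :
    dist p q ≤ 1 / ((l : ℝ) + 1) := by
  have hl : (0 : ℝ) < (l : ℝ) + 1 := by positivity
  simp only [gridIndex, Prod.mk.injEq] at h
  rw [Prod.dist_eq, Real.dist_eq, Real.dist_eq]
  exact max_le (abs_sub_le_of_floor_eq hl h.1) (abs_sub_le_of_floor_eq hl h.2)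

lemma dist_le_of_forall_gridIndex_eq {m l : ℕ} {p q : Fin m → ℝ × ℝ}
    (h : ∀ i, gridIndex l (p i) = gridIndex l (q i)) : dist p q ≤ 1 / ((l : ℝ) + 1) :=
  (dist_pi_le_iff (by positivity)).2 fun i => dist_le_of_gridIndex_eq (h i)

lemma isBounded_gridIndex_preimage (l : ℕ) (z : ℤ × ℤ) :
    Bornology.IsBounded (gridIndex l ⁻¹' {z}) := by
  rw [Metric.isBounded_iff]
  refine ⟨1 / ((l : ℝ) + 1), fun p hp q hq => dist_le_of_gridIndex_eq ?_⟩
  rw [Set.mem_preimage, Set.mem_singleton_iff] at hp hq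
  rw [hp, hq]

lemma measurableSet_gridIndex_preimage (l : ℕ) (z : ℤ × ℤ) :
    MeasurableSet (gridIndex l ⁻¹' {z}) :=
  measurable_gridIndex l (measurableSet_singleton z)

lemma tendsto_mesh : Tendsto (fun l : ℕ => 1 / ((l : ℝ) + 1)) atTop (𝓝 0) :=
  tendsto_one_div_add_atTop_nhds_zero_nat

/-- The index tuples of the products of grid cells that meet `A`. -/
def gridTuples {m : ℕ} (A : Set (Fin m → ℝ × ℝ)) (l : ℕ) : Set (Fin m → ℤ × ℤ) :=
  (fun p i => gridIndex l (p i)) '' A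

/-! ### First-moment bound for tuples of points of a Poisson process -/

section Poisson

variable {Ω : Type*} [MeasurableSpace Ω] {P : Measure Ω} {Pi : Ω → Set (ℝ × ℝ)}

lemma IsPoissonProcess.nonempty_iff (h : IsPoissonProcess P Pi) (ω : Ω) {B : Set (ℝ × ℝ)}
    (hb : Bornology.IsBounded B) : (Pi ω ∩ B).ncard ∈ ({0}ᶜ : Set ℕ) ↔ (Pi ω ∩ B).Nonempty := by
  rw [Set.mem_compl_singleton_iff, Ne, Set.ncard_eq_zero (h.locallyFinite ω B hb),
    Set.nonempty_iff_ne_empty]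

/-- The probability is `1 - exp (-v)`, where `v` is the area of `B`. -/
lemma IsPoissonProcess.measure_ncard_ne_zero_le (h : IsPoissonProcess P Pi) {B : Set (ℝ × ℝ)}
    (hB : MeasurableSet B) (hb : Bornology.IsBounded B) :
    P ((fun ω => (Pi ω ∩ B).ncard) ⁻¹' {0}ᶜ) ≤ volume B := by
  have hm := h.measurable_count B hB hb
  rw [← Measure.map_apply hm (measurableSet_singleton 0).compl, h.law_count B hB hb,
    prob_compl_eq_one_sub (measurableSet_singleton 0), poissonMeasure_singleton]
  have hfin : volume B ≠ ∞ := hb.measure_lt_top.ne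
  simp only [pow_zero, mul_one, Nat.factorial_zero, Nat.cast_one, div_one]
  rw [← ENNReal.ofReal_one, ← ENNReal.ofReal_sub _ (Real.exp_pos _).le]
  refine ENNReal.ofReal_le_of_le_toReal ?_
  have := Real.add_one_le_exp (-((volume B).toNNReal : ℝ))
  rw [ENNReal.coe_toNNReal_eq_toReal] at this ⊢
  linarith

/-- The event that some product of grid cells meeting `A` has a point of the process in each of
its factors. -/
def gridEvent (Pi : Ω → Set (ℝ × ℝ)) {m : ℕ} (A : Set (Fin m → ℝ × ℝ)) (l : ℕ) : Set Ω :=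
  ⋃ z ∈ gridTuples A l, ⋂ i, (fun ω => (Pi ω ∩ gridIndex l ⁻¹' {z i}).ncard) ⁻¹' {0}ᶜ

lemma IsPoissonProcess.mem_gridEvent_iff (h : IsPoissonProcess P Pi) {m : ℕ}
    {A : Set (Fin m → ℝ × ℝ)} {l : ℕ} {ω : Ω} :
    ω ∈ gridEvent Pi A l ↔
      ∃ p ∈ A, ∃ q : Fin m → ℝ × ℝ, ∀ i, q i ∈ Pi ω ∧ gridIndex l (q i) = gridIndex l (p i) := by
  simp only [gridEvent, gridTuples, Set.mem_iUnion, Set.mem_iInter, Set.mem_image,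
    exists_prop, Set.mem_preimage,
    fun z => h.nonempty_iff ω (isBounded_gridIndex_preimage l z)]
  constructor
  · rintro ⟨_, ⟨p, hp, rfl⟩, hz⟩
    choose q hq using hz
    exact ⟨p, hp, q, fun i => hq i⟩
  · rintro ⟨p, hp, q, hq⟩
    exact ⟨_, ⟨p, hp, rfl⟩, fun i => ⟨q i, hq i⟩⟩

lemma IsPoissonProcess.measurableSet_gridEvent (h : IsPoissonProcess P Pi) {m : ℕ}
    (A : Set (Fin m → ℝ × ℝ)) (l : ℕ) : MeasurableSet (gridEvent Pi A l) :=
  MeasurableSet.biUnion (Set.to_countable _) fun z _ => MeasurableSet.iInter fun i =>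
    h.measurable_count _ (measurableSet_gridIndex_preimage l (z i))
      (isBounded_gridIndex_preimage l (z i)) (measurableSet_singleton 0).compl

/-- By local finiteness only finitely many tuples of points of the process lie near `A`. If none
belonged to `A`, they would be at positive distance from the compact set `A`, which fine grids
exclude. This also yields measurability of the event. -/
lemma IsPoissonProcess.setOf_exists_eq_iInter (h : IsPoissonProcess P Pi) {m : ℕ}
    {A : Set (Fin m → ℝ × ℝ)} (hA : IsCompact A) :
    {ω | ∃ p ∈ A, ∀ i, p i ∈ Pi ω} = ⋂ l, gridEvent Pi A l := by
  ext ω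
  simp only [Set.mem_ofPred_eq, Set.mem_iInter, h.mem_gridEvent_iff]
  constructor
  · rintro ⟨p, hp, hpi⟩ l
    exact ⟨p, hp, p, fun i => ⟨hpi i, rfl⟩⟩
  · intro hl
    choose p hp q hq using hl
    have hd : ∀ l, dist (q l) (p l) ≤ 1 / ((l : ℝ) + 1) := fun l =>
      dist_le_of_forall_gridIndex_eq fun i => (hq l i).2
    obtain ⟨R, hR⟩ := (hA.isBounded.cthickening (δ := 1)).subset_closedBall 0
    have hqR : ∀ l, q l ∈ Metric.closedBall (0 : Fin m → ℝ × ℝ) R := fun l => by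
      refine hR (Metric.mem_cthickening_of_dist_le (q l) (p l) 1 A (hp l) ((hd l).trans ?_))
      rw [div_le_one (by positivity)]
      linarith [Nat.cast_nonneg (α := ℝ) l]
    have hfin : (Set.univ.pi fun _ : Fin m =>
        Pi ω ∩ Metric.closedBall (0 : ℝ × ℝ) R).Finite :=
      Set.Finite.pi fun _ => h.locallyFinite ω _ Metric.isBounded_closedBall
    have hmem : ∀ l, q l ∈ Set.univ.pi fun _ : Fin m =>
        Pi ω ∩ Metric.closedBall (0 : ℝ × ℝ) R := fun l i _ => by
      refine ⟨(hq l i).1, ?_⟩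
      have := hqR l
      rw [mem_closedBall_zero_iff] at this ⊢
      exact (norm_le_pi_norm (q l) i).trans this
    by_contra! hne
    have hdisj : Disjoint (Set.univ.pi fun _ : Fin m =>
        Pi ω ∩ Metric.closedBall (0 : ℝ × ℝ) R) A := Set.disjoint_left.2 fun r hr hrA => by
      obtain ⟨i, hi⟩ := hne r hrA
      exact hi (hr i trivial).1
    obtain ⟨δ, hδ, hδd⟩ := hdisj.exists_cthickenings hfin.isCompact hA.isClosed
    obtain ⟨l, hl⟩ := (tendsto_mesh.eventually_lt_const hδ).exists
    exact Set.disjoint_left.1 hδd (Metric.self_subset_cthickening _ (hmem l))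
      (Metric.mem_cthickening_of_dist_le _ _ _ _ (hp l) ((hd l).trans hl.le))

/-- Once the mesh is below the separation, the entries of a tuple occupy distinct cells, so
independence turns the probability into a product of at most the cell areas. The resulting boxes are
disjoint and stay within one mesh of `A`. -/
lemma IsPoissonProcess.measure_gridEvent_le (h : IsPoissonProcess P Pi) {m : ℕ}
    (A : Set (Fin m → ℝ × ℝ)) {δ : ℝ} (hδ : ∀ p ∈ A, ∀ i j, i ≠ j → δ ≤ dist (p i) (p j))
    {l : ℕ} (hl : 1 / ((l : ℝ) + 1) < δ) :
    P (gridEvent Pi A l) ≤ volume (Metric.cthickening (1 / ((l : ℝ) + 1)) A) := by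
  have key : ∀ z ∈ gridTuples A l,
      P (⋂ i, (fun ω => (Pi ω ∩ gridIndex l ⁻¹' {z i}).ncard) ⁻¹' {0}ᶜ) ≤
        volume (Set.univ.pi fun i => gridIndex l ⁻¹' {z i}) := by
    rintro _ ⟨p, hp, rfl⟩
    have hind := h.indep_count m (fun i => gridIndex l ⁻¹' {gridIndex l (p i)})
      (fun i => measurableSet_gridIndex_preimage _ _)
      (fun i => isBounded_gridIndex_preimage _ _) (fun i j hij => by
        refine Disjoint.preimage _ (Set.disjoint_singleton.2 fun heq => ?_)
        exact absurd (dist_le_of_gridIndex_eq heq) (not_le.2 (hl.trans_le (hδ p hp i j hij))))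
    have := hind.measure_inter_preimage_eq_mul Finset.univ (sets := fun _ => {0}ᶜ)
      (fun i _ => (measurableSet_singleton 0).compl)
    simp only [Finset.mem_univ, Set.iInter_true] at this
    rw [this, volume_pi_pi]
    exact Finset.prod_le_prod' fun i _ => h.measure_ncard_ne_zero_le
      (measurableSet_gridIndex_preimage _ _) (isBounded_gridIndex_preimage _ _)
  calc P (gridEvent Pi A l)
      ≤ ∑' z : gridTuples A l,
          P (⋂ i, (fun ω => (Pi ω ∩ gridIndex l ⁻¹' {z.1 i}).ncard) ⁻¹' {0}ᶜ) :=
        measure_biUnion_le _ (Set.to_countable _) _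
    _ ≤ ∑' z : gridTuples A l, volume (Set.univ.pi fun i => gridIndex l ⁻¹' {z.1 i}) :=
        ENNReal.tsum_le_tsum fun z => key z.1 z.2
    _ = volume (⋃ z ∈ gridTuples A l, Set.univ.pi fun i => gridIndex l ⁻¹' {z i}) := by
        rw [measure_biUnion (Set.to_countable _)]
        · intro z _ w _ hzw
          refine Set.disjoint_left.2 fun q hq hq' => hzw (funext fun i => ?_)
          have h1 : gridIndex l (q i) = z i := hq i trivial
          have h2 : gridIndex l (q i) = w i := hq' i trivial
          rw [← h1, h2]
        · exact fun z _ => MeasurableSet.univ_pi fun i => measurableSet_gridIndex_preimage _ _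
    _ ≤ volume (Metric.cthickening (1 / ((l : ℝ) + 1)) A) := by
        refine measure_mono (Set.iUnion₂_subset ?_)
        rintro _ ⟨p, hp, rfl⟩ q hq
        exact Metric.mem_cthickening_of_dist_le q p _ A hp
          (dist_le_of_forall_gridIndex_eq fun i => hq i trivial)

/-- For a compact set `A` of tuples with separated entries, the probability that a Poisson process
of intensity `1` contains all the entries of some tuple in `A` is at most the volume of `A`. -/
theorem IsPoissonProcess.measure_exists_le (h : IsPoissonProcess P Pi) {m : ℕ}
    {A : Set (Fin m → ℝ × ℝ)} (hA : IsCompact A) {δ : ℝ} (hδ : 0 < δ)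
    (hsep : ∀ p ∈ A, ∀ i j, i ≠ j → δ ≤ dist (p i) (p j)) :
    P {ω | ∃ p ∈ A, ∀ i, p i ∈ Pi ω} ≤ volume A := by
  refine ge_of_tendsto ((tendsto_measure_cthickening_of_isCompact hA).comp tendsto_mesh) ?_
  filter_upwards [tendsto_mesh.eventually_lt_const hδ] with l hl
  rw [h.setOf_exists_eq_iInter hA]
  exact (measure_mono (Set.iInter_subset _ l)).trans (h.measure_gridEvent_le A hsep hl)

lemma IsPoissonProcess.measurableSet_exists (h : IsPoissonProcess P Pi) {m : ℕ}
    {A : Set (Fin m → ℝ × ℝ)} (hA : IsCompact A) :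
    MeasurableSet {ω | ∃ p ∈ A, ∀ i, p i ∈ Pi ω} := by
  rw [h.setOf_exists_eq_iInter hA]
  exact MeasurableSet.iInter fun l => h.measurableSet_gridEvent A l

end Poisson


/-! ### Compact exhaustion of the set of chains -/

/-- The set of all `k`-monotone chains of length `m` in the cell `C_k(a,b)`. -/
def chainSet (k : ℕ) (a b : ℝ) (m : ℕ) : Set (Fin m → ℝ × ℝ) :=
  {p | IsMonotoneChain k a b Set.univ p}

/-- The tuples in `(a,b) × ℝ` whose first coordinates increase by at least `δ` at each step, and
keep distance at least `δ` from `a` and `b`. -/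
def gapSet (a b δ : ℝ) (m : ℕ) : Set (Fin m → ℝ × ℝ) :=
  {p | (∀ i j, i < j → δ ≤ (p j).1 - (p i).1) ∧ ∀ i, δ ≤ (p i).1 - a ∧ δ ≤ b - (p i).1}

lemma isMonotoneChain_iff {k : ℕ} {a b : ℝ} {S : Set (ℝ × ℝ)} {m : ℕ} {p : Fin m → ℝ × ℝ} :
    IsMonotoneChain k a b S p ↔ p ∈ chainSet k a b m ∧ ∀ i, p i ∈ S :=
  ⟨fun h => ⟨⟨fun i => ⟨trivial, (h.mem i).2⟩, h.2, h.3, h.4, h.5⟩, fun i => (h.mem i).1⟩,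
    fun h => ⟨fun i => ⟨h.2 i, (h.1.mem i).2⟩, h.1.2, h.1.3, h.1.4, h.1.5⟩⟩

/-- `hpat` fixes the pattern of coinciding abscissas on `U`, so each level of the recursion stays in
one branch and no denominator vanishes. -/
lemma continuousOn_divDiff {X : Type*} [TopologicalSpace X] {f : ℝ → ℝ}
    (hf : ∀ j, Continuous (iteratedDeriv j f)) {U : Set X} (j : ℕ)
    (q : X → Fin (j + 1) → ℝ × ℝ) (hq : ∀ i, ContinuousOn (fun x => q x i) U)
    (hpat : ∀ i i', (∀ x ∈ U, (q x i).1 = (q x i').1) ∨ ∀ x ∈ U, (q x i).1 ≠ (q x i').1) :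
    ContinuousOn (fun x => divDiff f j (q x)) U := by
  induction j with
  | zero => exact continuous_snd.comp_continuousOn (hq 0)
  | succ j ih =>
    rcases hpat (Fin.last (j + 1)) 0 with h | h
    · refine ContinuousOn.congr (f := fun x =>
        iteratedDeriv (j + 1) f (q x 0).1 / ((j + 1)! : ℝ)) ?_ fun x hx => if_pos (h x hx)
      exact ((hf _).comp_continuousOn (continuous_fst.comp_continuousOn (hq 0))).div_const _
    · refine ContinuousOn.congr (f := fun x =>
        (divDiff f j (Fin.tail (q x)) - divDiff f j (Fin.init (q x))) /
          ((q x (Fin.last (j + 1))).1 - (q x 0).1)) ?_ fun x hx => if_neg (h x hx)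
      refine ((ih _ (fun i => hq i.succ) fun i i' => hpat _ _).sub
        (ih _ (fun i => hq i.castSucc) fun i i' => hpat _ _)).div
        ((continuous_fst.comp_continuousOn (hq _)).sub
          (continuous_fst.comp_continuousOn (hq _))) fun x hx => sub_ne_zero.2 (h x hx)

lemma continuous_iteratedDeriv_pow (k j : ℕ) :
    Continuous (iteratedDeriv j fun x : ℝ => x ^ k) :=
  (contDiff_id.pow k : ContDiff ℝ j fun x : ℝ => x ^ k).continuous_iteratedDeriv j le_rfl

lemma continuous_extend (k : ℕ) (a b : ℝ) {m : ℕ} (i : Fin (k + m + k)) :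
    Continuous fun p : Fin m → ℝ × ℝ => extend k a b p i := by
  refine Fin.addCases (fun i => Fin.addCases (fun i => ?_) (fun i => ?_) i) (fun i => ?_) i
  · simp only [extend, Fin.append_right]
    exact continuous_const
  · simp only [extend, Fin.append_left]
    exact continuous_const
  · simp only [extend, Fin.append_left, Fin.append_right]
    exact continuous_apply i

lemma extend_fst_eq_or_ne (k : ℕ) {a b : ℝ} (hab : a < b) {δ : ℝ} (hδ : 0 < δ) {m : ℕ}
    (i i' : Fin (k + m + k)) :
    (∀ p ∈ gapSet a b δ m, (extend k a b p i).1 = (extend k a b p i').1) ∨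
      ∀ p ∈ gapSet a b δ m, (extend k a b p i).1 ≠ (extend k a b p i').1 := by
  have ha : ∀ p ∈ gapSet a b δ m, ∀ i, a < (p i).1 := fun p hp i => by
    linarith [(hp.2 i).1]
  have hb : ∀ p ∈ gapSet a b δ m, ∀ i, (p i).1 < b := fun p hp i => by
    linarith [(hp.2 i).2]
  have hp' : ∀ p ∈ gapSet a b δ m, StrictMono fun i => (p i).1 := fun p hp i j hij => by
    have := hp.1 i j hij
    dsimp only
    linarith
  refine Fin.addCases (fun i => Fin.addCases (fun i => ?_) (fun i => ?_) i) (fun i => ?_) i <;>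
  refine Fin.addCases (fun j => Fin.addCases (fun j => ?_) (fun j => ?_) j) (fun j => ?_) i' <;>
  simp only [extend, Fin.append_left, Fin.append_right, gamma]
  · simp
  · exact Or.inr fun p hp => hab.ne'
  · exact Or.inr fun p hp => (hb p hp j).ne'
  · exact Or.inr fun p hp => hab.ne
  · simp
  · exact Or.inr fun p hp => (ha p hp j).ne
  · exact Or.inr fun p hp => (hb p hp i).ne
  · exact Or.inr fun p hp => (ha p hp i).ne'
  · rcases eq_or_ne i j with rfl | hij
    · exact Or.inl fun p hp => rfl
    · exact Or.inr fun p hp => (hp' p hp).injective.ne hij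

lemma isClosed_gapSet (a b δ : ℝ) (m : ℕ) : IsClosed (gapSet a b δ m) := by
  have hc : ∀ i : Fin m, Continuous fun p : Fin m → ℝ × ℝ => (p i).1 := fun i =>
    continuous_fst.comp (continuous_apply i)
  simp only [gapSet, Set.ofPred_and, Set.ofPred_forall]
  refine (isClosed_iInter fun i => isClosed_iInter fun j => isClosed_iInter fun _ => ?_).inter
    (isClosed_iInter fun i => IsClosed.inter ?_ ?_)
  · exact isClosed_le continuous_const ((hc j).sub (hc i))
  · exact isClosed_le continuous_const ((hc i).sub continuous_const)
  · exact isClosed_le continuous_const (continuous_const.sub (hc i))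

lemma continuous_lowerBoundary (k : ℕ) (a b : ℝ) : Continuous (lowerBoundary k a b) := by
  unfold lowerBoundary Phi Psi
  split_ifs <;> fun_prop

lemma continuous_upperBoundary (k : ℕ) (a b : ℝ) : Continuous (upperBoundary k a b) := by
  unfold upperBoundary Phi Psi
  split_ifs <;> fun_prop

/-- This compactness is all that the proof uses of the cell; the volume estimate relies on
monotonicity and the abscissas alone. -/
lemma isCompact_cell (k : ℕ) (a b : ℝ) : IsCompact (cell k a b) := by
  obtain ⟨l, hl⟩ := (isCompact_Icc.bddBelow_image
    (continuous_lowerBoundary k a b).continuousOn : BddBelow (_ '' Set.Icc a b))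
  obtain ⟨u, hu⟩ := (isCompact_Icc.bddAbove_image
    (continuous_upperBoundary k a b).continuousOn : BddAbove (_ '' Set.Icc a b))
  refine (isCompact_Icc.prod isCompact_Icc : IsCompact (Set.Icc a b ×ˢ Set.Icc l u)).of_isClosed_subset
    ?_ ?_
  · exact (isClosed_le continuous_const continuous_fst).inter
      ((isClosed_le continuous_fst continuous_const).inter
      ((isClosed_le ((continuous_lowerBoundary k a b).comp continuous_fst) continuous_snd).inter
      (isClosed_le continuous_snd ((continuous_upperBoundary k a b).comp continuous_fst))))
  · rintro ⟨x, y⟩ ⟨h1, h2, h3, h4⟩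
    exact ⟨⟨h1, h2⟩, (hl ⟨x, ⟨h1, h2⟩, rfl⟩).trans h3, h4.trans (hu ⟨x, ⟨h1, h2⟩, rfl⟩)⟩

lemma mem_chainSet_inter_gapSet_iff {k : ℕ} {a b δ : ℝ} (hδ : 0 < δ) {m : ℕ}
    {p : Fin m → ℝ × ℝ} :
    p ∈ chainSet k a b m ∩ gapSet a b δ m ↔
      p ∈ (Set.univ.pi fun _ => cell k a b) ∩ ⋂ s : Fin (k + 1) ↪o Fin (k + m + k),
        gapSet a b δ m ∩ (fun p => divDiff (fun x => x ^ k) k (extend k a b p ∘ s)) ⁻¹' Set.Ici 0 ∧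
      p ∈ gapSet a b δ m := by
  constructor
  · rintro ⟨h, hg⟩
    exact ⟨⟨fun i _ => (h.mem i).2, Set.mem_iInter.2 fun s => ⟨hg, h.monotone s⟩⟩, hg⟩
  · rintro ⟨⟨hc, hs⟩, hg⟩
    refine ⟨⟨fun i => ⟨trivial, hc i trivial⟩, fun i j hij => ?_, fun i => ?_, fun i => ?_,
      fun s => (Set.mem_iInter.1 hs s).2⟩, hg⟩
    · have := hg.1 i j hij
      dsimp only
      linarith
    · linarith [(hg.2 i).1]
    · linarith [(hg.2 i).2]

lemma isCompact_chainSet_inter_gapSet (k : ℕ) {a b : ℝ} (hab : a < b) {δ : ℝ} (hδ : 0 < δ)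
    (m : ℕ) : IsCompact (chainSet k a b m ∩ gapSet a b δ m) := by
  have : chainSet k a b m ∩ gapSet a b δ m =
      ((Set.univ.pi fun _ => cell k a b) ∩ ⋂ s : Fin (k + 1) ↪o Fin (k + m + k),
        gapSet a b δ m ∩ (fun p => divDiff (fun x => x ^ k) k (extend k a b p ∘ s)) ⁻¹' Set.Ici 0)
      ∩ gapSet a b δ m := Set.ext fun p => mem_chainSet_inter_gapSet_iff hδ
  rw [this]
  refine ((isCompact_univ_pi fun _ => isCompact_cell k a b).inter_right
    (isClosed_iInter fun s => ?_)).inter_right (isClosed_gapSet a b δ m)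
  -- Divided differences are continuous only relative to `gapSet`, hence the intersection with the
  -- closed set `gapSet` inside each condition.
  exact (continuousOn_divDiff (continuous_iteratedDeriv_pow k) k _
    (fun i => (continuous_extend k a b (s i)).continuousOn)
    fun i i' => extend_fst_eq_or_ne k hab hδ _ _).preimage_isClosed_of_isClosed
    (isClosed_gapSet a b δ m) isClosed_Ici

lemma exists_mem_gapSet {k : ℕ} {a b : ℝ} {m : ℕ} {p : Fin m → ℝ × ℝ}
    (hp : p ∈ chainSet k a b m) : ∃ r : ℕ, p ∈ gapSet a b (1 / ((r : ℝ) + 1)) m := by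
  have h1 : ∀ c : ℝ, 0 < c → ∀ᶠ r : ℕ in Filter.atTop, 1 / ((r : ℝ) + 1) ≤ c := fun c hc =>
    tendsto_mesh.eventually_le_const hc
  have h2 : ∀ᶠ r : ℕ in Filter.atTop, p ∈ gapSet a b (1 / ((r : ℝ) + 1)) m := by
    refine Filter.Eventually.and ?_ ?_
    · refine Filter.eventually_all.2 fun i => Filter.eventually_all.2 fun j =>
        Filter.eventually_all.2 fun hij => h1 _ (sub_pos.2 (hp.strictMono hij))
    · exact Filter.eventually_all.2 fun i => (h1 _ (sub_pos.2 (hp.left_lt i))).and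
        (h1 _ (sub_pos.2 (hp.lt_right i)))
  exact h2.exists

lemma gapSet_anti (a b : ℝ) (m : ℕ) : Antitone fun δ => gapSet a b δ m :=
  fun _ _ h _ hp => ⟨fun i j hij => h.trans (hp.1 i j hij),
    fun i => ⟨h.trans (hp.2 i).1, h.trans (hp.2 i).2⟩⟩

/-- The strict inequalities between abscissas keep `chainSet` from being closed in general; positive
minimal gaps exhaust it by compact sets to which the Poisson bound applies. -/
lemma chainSet_eq_iUnion (k : ℕ) (a b : ℝ) (m : ℕ) :
    chainSet k a b m = ⋃ r : ℕ, chainSet k a b m ∩ gapSet a b (1 / ((r : ℝ) + 1)) m := by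
  rw [← Set.inter_iUnion]
  exact (Set.inter_eq_left.2 fun p hp => Set.mem_iUnion.2 (exists_mem_gapSet hp)).symm

lemma measurableSet_chainSet (k : ℕ) {a b : ℝ} (hab : a < b) (m : ℕ) :
    MeasurableSet (chainSet k a b m) := by
  rw [chainSet_eq_iUnion]
  exact MeasurableSet.iUnion fun r =>
    (isCompact_chainSet_inter_gapSet k hab (by positivity) m).measurableSet

lemma setOf_exists_isMonotoneChain {Ω : Type*} (k : ℕ) (a b : ℝ) (m : ℕ)
    (Pi : Ω → Set (ℝ × ℝ)) :
    {ω | ∃ p : Fin m → ℝ × ℝ, IsMonotoneChain k a b (Pi ω) p} =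
      ⋃ r : ℕ, {ω | ∃ p ∈ chainSet k a b m ∩ gapSet a b (1 / ((r : ℝ) + 1)) m,
        ∀ i, p i ∈ Pi ω} := by
  ext ω
  simp only [isMonotoneChain_iff, Set.mem_iUnion, Set.mem_ofPred_eq]
  constructor
  · rintro ⟨p, hp, hi⟩
    obtain ⟨r, hr⟩ := exists_mem_gapSet hp
    exact ⟨r, p, ⟨hp, hr⟩, hi⟩
  · rintro ⟨r, p, hp, hi⟩
    exact ⟨p, hp.1, hi⟩

section Poisson

variable {Ω : Type*} [MeasurableSpace Ω] {P : Measure Ω} {Pi : Ω → Set (ℝ × ℝ)}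

lemma IsPoissonProcess.measurableSet_exists_isMonotoneChain (h : IsPoissonProcess P Pi) (k : ℕ)
    {a b : ℝ} (hab : a < b) (m : ℕ) :
    MeasurableSet {ω | ∃ p : Fin m → ℝ × ℝ, IsMonotoneChain k a b (Pi ω) p} := by
  rw [setOf_exists_isMonotoneChain]
  exact MeasurableSet.iUnion fun r =>
    h.measurableSet_exists (isCompact_chainSet_inter_gapSet k hab (by positivity) m)

/-- The probability that there is a chain of length `m` is at most the volume of the set of all
chains of length `m`. -/
lemma IsPoissonProcess.measure_exists_isMonotoneChain_le (h : IsPoissonProcess P Pi) (k : ℕ)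
    {a b : ℝ} (hab : a < b) (m : ℕ) :
    P {ω | ∃ p : Fin m → ℝ × ℝ, IsMonotoneChain k a b (Pi ω) p} ≤
      volume (chainSet k a b m) := by
  rw [setOf_exists_isMonotoneChain, Monotone.measure_iUnion]
  · refine iSup_le fun r => ?_
    refine (h.measure_exists_le (isCompact_chainSet_inter_gapSet k hab (by positivity) m)
      (by positivity : 0 < 1 / ((r : ℝ) + 1)) ?_).trans (measure_mono Set.inter_subset_left)
    intro p hp i j hij
    have key : ∀ i j, i < j → 1 / ((r : ℝ) + 1) ≤ dist (p j) (p i) := fun i j hij => by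
      rw [Prod.dist_eq]
      exact (hp.2.1 i j hij).trans ((le_abs_self _).trans (le_max_left _ _))
    rcases lt_or_gt_of_ne hij with hij | hij
    · rw [dist_comm]
      exact key i j hij
    · exact key j i hij
  · rintro r s hrs ω ⟨p, hp, hi⟩
    refine ⟨p, ⟨hp.1, gapSet_anti a b m ?_ hp.2⟩, hi⟩
    gcongr

end Poisson


/-! ### Windows of an extended tuple -/

/-- The extended tuple `(γ_k(a)^{∘ k}, p_1, …, p_m, γ_k(b), γ_k(b), …)`, indexed by `ℕ`. -/
def nodes (k : ℕ) (a b : ℝ) {m : ℕ} (p : Fin m → ℝ × ℝ) (i : ℕ) : ℝ × ℝ :=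
  if i < k then gamma k a else if h : i - k < m then p ⟨i - k, h⟩ else gamma k b

section Nodes

variable {k : ℕ} {a b : ℝ} {m : ℕ} {p : Fin m → ℝ × ℝ}

lemma nodes_of_lt {i : ℕ} (h : i < k) : nodes k a b p i = gamma k a := if_pos h

lemma nodes_of_ge {i : ℕ} (h : k + m ≤ i) : nodes k a b p i = gamma k b := by
  rw [nodes, if_neg (by omega), dif_neg (by omega)]

lemma nodes_add (j : Fin m) : nodes k a b p (j + k) = p j := by
  simp [nodes]

lemma extend_eq_nodes (i : Fin (k + m + k)) : extend k a b p i = nodes k a b p i := by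
  refine Fin.addCases (fun i => Fin.addCases (fun i => ?_) (fun i => ?_) i) (fun i => ?_) i
  · simp only [extend, Fin.append_right, Fin.val_natAdd]
    rw [nodes_of_ge (by omega)]
  · simp only [extend, Fin.append_left, Fin.val_castAdd]
    rw [nodes_of_lt i.2]
  · simp only [extend, Fin.append_left, Fin.append_right, Fin.val_castAdd, Fin.val_natAdd]
    rw [add_comm, nodes_add]

lemma nodes_cases (k : ℕ) (a b : ℝ) {m : ℕ} (i : ℕ) :
    (i < k ∧ ∀ p : Fin m → ℝ × ℝ, nodes k a b p i = gamma k a) ∨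
      (∃ j : Fin m, i = j + k ∧ ∀ p : Fin m → ℝ × ℝ, nodes k a b p i = p j) ∨
      (k + m ≤ i ∧ ∀ p : Fin m → ℝ × ℝ, nodes k a b p i = gamma k b) := by
  by_cases h1 : i < k
  · exact Or.inl ⟨h1, fun p => nodes_of_lt h1⟩
  by_cases h2 : k + m ≤ i
  · exact Or.inr (Or.inr ⟨h2, fun p => nodes_of_ge h2⟩)
  · refine Or.inr (Or.inl ⟨⟨i - k, by omega⟩, by simp; omega, fun p => ?_⟩)
    rw [nodes, if_neg h1, dif_pos (by omega)]

/-- The `x`-coordinates of `nodes`, in terms of those of the tuple. -/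
def nodesFst (k : ℕ) (a b : ℝ) {m : ℕ} (x : Fin m → ℝ) (i : ℕ) : ℝ :=
  if i < k then a else if h : i - k < m then x ⟨i - k, h⟩ else b

lemma nodes_fst (i : ℕ) : (nodes k a b p i).1 = nodesFst k a b (fun j => (p j).1) i := by
  unfold nodes nodesFst gamma
  split_ifs <;> rfl

/-- The set of increasing tuples in `(a, b)`. -/
def incSet (a b : ℝ) (m : ℕ) : Set (Fin m → ℝ) :=
  {x | StrictMono x ∧ ∀ i, a < x i ∧ x i < b}

variable {x : Fin m → ℝ}

lemma nodesFst_of_lt {i : ℕ} (h : i < k) : nodesFst k a b x i = a := if_pos h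

lemma nodesFst_of_ge {i : ℕ} (h : k + m ≤ i) : nodesFst k a b x i = b := by
  rw [nodesFst, if_neg (by omega), dif_neg (by omega)]

lemma nodesFst_add (j : Fin m) : nodesFst k a b x (j + k) = x j := by
  simp [nodesFst]

/-- The conditions `h1` and `h2` exclude that both indices fall in the block of copies of `a`, or
both in the block of copies of `b`. -/
lemma nodesFst_lt (hab : a < b) (hx : x ∈ incSet a b m) {i i' : ℕ} (hii : i < i')
    (h1 : k ≤ i') (h2 : i < k + m) : nodesFst k a b x i < nodesFst k a b x i' := by
  unfold nodesFst
  rw [if_neg (by omega : ¬ i' < k)]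
  split_ifs with h3 h4 h4
  · exact (hx.2 _).1
  · exact hab
  · exact hx.1 (Fin.mk_lt_mk.2 (by omega))
  · exact (hx.2 _).2
  · omega
  · omega

lemma nodesFst_mono (hab : a < b) (hx : x ∈ incSet a b m) : Monotone (nodesFst k a b x) := by
  intro i i' hii
  rcases hii.eq_or_lt with rfl | hii
  · rfl
  by_cases h1 : i' < k
  · rw [nodesFst_of_lt h1, nodesFst_of_lt (hii.trans h1)]
  by_cases h2 : k + m ≤ i
  · rw [nodesFst_of_ge h2, nodesFst_of_ge (by omega)]
  · exact (nodesFst_lt hab hx hii (by omega) (by omega)).le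

end Nodes

/-- The `j`-th divided difference of `j + 1` consecutive entries, starting at the index `i`. -/
noncomputable def windowDiff (f : ℝ → ℝ) (j : ℕ) (q : ℕ → ℝ × ℝ) (i : ℕ) : ℝ :=
  divDiff f j fun t : Fin (j + 1) => q (i + t)

lemma windowDiff_succ {f : ℝ → ℝ} {j : ℕ} {q : ℕ → ℝ × ℝ} {i : ℕ}
    (h : (q i).1 ≠ (q (i + (j + 1))).1) :
    windowDiff f (j + 1) q i * ((q (i + (j + 1))).1 - (q i).1) =
      windowDiff f j q (i + 1) - windowDiff f j q i := by
  have h1 : Fin.tail (fun t : Fin (j + 1 + 1) => q (i + t)) =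
      fun t : Fin (j + 1) => q (i + 1 + t) := by
    funext t
    simp only [Fin.tail, Fin.val_succ]
    congr 1
    omega
  have h2 : Fin.init (fun t : Fin (j + 1 + 1) => q (i + t)) =
      fun t : Fin (j + 1) => q (i + t) := rfl
  unfold windowDiff
  rw [divDiff, h1, h2]
  simp only [Fin.val_last, Fin.val_zero, add_zero]
  rw [if_neg h.symm, div_mul_cancel₀ _ (sub_ne_zero.2 h.symm)]

lemma windowDiff_gamma (K : ℕ) (c : ℝ) {q : ℕ → ℝ × ℝ} {i : ℕ}
    (h : ∀ t ≤ K, q (i + t) = gamma (K + 1) c) :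
    windowDiff (fun x => x ^ (K + 1)) K q i = (K + 1) * c := by
  have : (fun t : Fin (K + 1) => q (i + t)) = fun _ => gamma (K + 1) c :=
    funext fun t => h t (by omega)
  rw [windowDiff, this]
  cases K with
  | zero => simp [divDiff, gamma]
  | succ K =>
    rw [divDiff, if_pos rfl]
    simp only [gamma]
    have h1 := Nat.factorial_mul_descFactorial (show K + 1 ≤ K + 1 + 1 by omega)
    rw [show K + 1 + 1 - (K + 1) = 1 by omega, Nat.factorial_one, one_mul] at h1
    rw [iteratedDeriv_pow, h1, show K + 1 + 1 - (K + 1) = 1 by omega, Nat.factorial_succ (K + 1)]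
    have h2 : ((K + 1)! : ℝ) ≠ 0 := Nat.cast_ne_zero.2 (Nat.factorial_ne_zero _)
    push_cast
    field_simp

/-- Only windows of consecutive nodes are used from the monotonicity condition. -/
lemma windowDiff_nonneg {k : ℕ} {a b : ℝ} {m : ℕ} {p : Fin m → ℝ × ℝ}
    (hp : p ∈ chainSet k a b m) {i : ℕ} (hi : i < m + k) :
    0 ≤ windowDiff (fun x => x ^ k) k (nodes k a b p) i := by
  let s : Fin (k + 1) ↪o Fin (k + m + k) :=
    OrderEmbedding.ofStrictMono (fun t => ⟨i + t, by omega⟩) fun t t' h =>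
      Fin.mk_lt_mk.2 (Nat.add_lt_add_left h i)
  have hs : extend k a b p ∘ s = fun t : Fin (k + 1) => nodes k a b p (i + t) :=
    funext fun t => extend_eq_nodes _
  have := hp.monotone s
  rwa [hs] at this

/-- The increments of the divided differences of order `K` of consecutive entries. -/
noncomputable def increment (K : ℕ) (a b : ℝ) {m : ℕ} (p : Fin m → ℝ × ℝ) (i : ℕ) : ℝ :=
  windowDiff (fun x => x ^ (K + 1)) K (nodes (K + 1) a b p) (i + 1) -
    windowDiff (fun x => x ^ (K + 1)) K (nodes (K + 1) a b p) i

lemma fst_mem_incSet {k : ℕ} {a b : ℝ} {m : ℕ} {p : Fin m → ℝ × ℝ}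
    (hp : p ∈ chainSet k a b m) : (fun j => (p j).1) ∈ incSet a b m :=
  ⟨hp.strictMono, fun i => ⟨hp.left_lt i, hp.lt_right i⟩⟩

lemma increment_nonneg {K : ℕ} {a b : ℝ} (hab : a < b) {m : ℕ} {p : Fin m → ℝ × ℝ}
    (hp : p ∈ chainSet (K + 1) a b m) {i : ℕ} (hi : i < m + (K + 1)) :
    0 ≤ increment K a b p i := by
  have hlt : (nodes (K + 1) a b p i).1 < (nodes (K + 1) a b p (i + (K + 1))).1 := by
    rw [nodes_fst, nodes_fst]
    exact nodesFst_lt hab (fst_mem_incSet hp) (by omega) (by omega) (by omega)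
  rw [increment, ← windowDiff_succ hlt.ne]
  exact mul_nonneg (windowDiff_nonneg hp hi) (sub_pos.2 hlt).le

lemma sum_increment_le {K : ℕ} {a b : ℝ} (hab : a < b) {m : ℕ} {p : Fin m → ℝ × ℝ}
    (hp : p ∈ chainSet (K + 1) a b m) :
    ∑ j : Fin m, increment K a b p j ≤ (K + 1) * (b - a) := by
  rw [Fin.sum_univ_eq_sum_range (fun i => increment K a b p i) m]
  -- The `K + 1` extra increments are nonnegative, and with them the telescoping sum runs from a
  -- window consisting of copies of `γ(a)` to one consisting of copies of `γ(b)`.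
  calc ∑ i ∈ Finset.range m, increment K a b p i
      ≤ ∑ i ∈ Finset.range (m + (K + 1)), increment K a b p i :=
        Finset.sum_le_sum_of_subset_of_nonneg (Finset.range_mono (by omega))
          fun i hi _ => increment_nonneg hab hp (Finset.mem_range.1 hi)
    _ = (K + 1) * (b - a) := by
        simp only [increment]
        rw [Finset.sum_range_sub, windowDiff_gamma K b fun t ht => nodes_of_ge (by omega),
          windowDiff_gamma K a fun t ht => nodes_of_lt (by omega)]
        ring

/-! ### Triangular affine maps -/

/-- `F` is an affine function of the coordinates up to `J`, with coefficient `e` at `J`. -/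
def IsLead {m : ℕ} (F : (Fin m → ℝ) → ℝ) (J : Fin m) (e : ℝ) : Prop :=
  ∃ (l : Fin m → ℝ) (c : ℝ), (∀ y, F y = l ⬝ᵥ y + c) ∧ (∀ i, J < i → l i = 0) ∧ l J = e

section IsLead

variable {m : ℕ} {J : Fin m}

lemma isLead_const (c : ℝ) : IsLead (fun _ => c) J 0 :=
  ⟨0, c, fun y => by simp, fun i _ => rfl, rfl⟩

lemma isLead_apply : IsLead (fun y => y J) J 1 :=
  ⟨Pi.single J 1, 0, fun y => by simp, fun i hi => by simp [hi.ne'], by simp⟩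

lemma isLead_apply_of_lt {i : Fin m} (h : i < J) : IsLead (fun y => y i) J 0 :=
  ⟨Pi.single i 1, 0, fun y => by simp, fun i' hi => by simp [(h.trans hi).ne'], by simp [h.ne']⟩

lemma IsLead.sub {F G : (Fin m → ℝ) → ℝ} {e e' : ℝ} (hF : IsLead F J e) (hG : IsLead G J e') :
    IsLead (fun y => F y - G y) J (e - e') := by
  obtain ⟨l, c, h1, h2, h3⟩ := hF
  obtain ⟨l', c', h1', h2', h3'⟩ := hG
  refine ⟨l - l', c - c', fun y => ?_, fun i hi => ?_, ?_⟩
  · simp only [h1, h1', sub_dotProduct]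
    ring
  · simp [h2 i hi, h2' i hi]
  · simp [h3, h3']

lemma IsLead.div_const {F : (Fin m → ℝ) → ℝ} {e : ℝ} (hF : IsLead F J e) (d : ℝ) :
    IsLead (fun y => F y / d) J (e / d) := by
  obtain ⟨l, c, h1, h2, h3⟩ := hF
  refine ⟨d⁻¹ • l, c / d, fun y => ?_, fun i hi => ?_, ?_⟩
  · simp only [h1, smul_dotProduct, smul_eq_mul]
    ring
  · simp [h2 i hi]
  · simp only [Pi.smul_apply, h3, smul_eq_mul]
    ring

/-- The abscissas do not depend on `y`, so neither does the branch taken; the branch for repeated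
points is constant in `y`. -/
lemma isLead_divDiff_zero (f : ℝ → ℝ) (j : ℕ) (q : (Fin m → ℝ) → Fin (j + 1) → ℝ × ℝ)
    (X : Fin (j + 1) → ℝ) (hX : ∀ y i, (q y i).1 = X i)
    (hY : ∀ i, IsLead (fun y => (q y i).2) J 0) : IsLead (fun y => divDiff f j (q y)) J 0 := by
  induction j with
  | zero => exact hY 0
  | succ j ih =>
    simp only [divDiff, hX]
    split_ifs
    · exact isLead_const _
    · have := ((ih (fun y => Fin.tail (q y)) (Fin.tail X) (fun y i => hX y _) fun i => hY _).sub
        (ih (fun y => Fin.init (q y)) (Fin.init X) (fun y i => hX y _) fun i => hY _)).div_const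
        (X (Fin.last (j + 1)) - X 0)
      simpa using this

/-- In the recursion only the tail contains the last ordinate, and each level divides its
coefficient by one more difference of abscissas. -/
lemma isLead_divDiff (f : ℝ → ℝ) (j : ℕ) (q : (Fin m → ℝ) → Fin (j + 1) → ℝ × ℝ)
    (X : Fin (j + 1) → ℝ) (hX : ∀ y i, (q y i).1 = X i)
    (hne : ∀ i : Fin j, X i.castSucc ≠ X (Fin.last j))
    (hY : ∀ i : Fin j, IsLead (fun y => (q y i.castSucc).2) J 0) {e : ℝ}
    (he : IsLead (fun y => (q y (Fin.last j)).2) J e) :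
    IsLead (fun y => divDiff f j (q y)) J (e / ∏ i : Fin j, (X (Fin.last j) - X i.castSucc)) := by
  induction j with
  | zero => simpa [divDiff] using he
  | succ j ih =>
    have h1 := ih (fun y => Fin.tail (q y)) (Fin.tail X) (fun y i => hX y _)
      (fun i => hne i.succ) (fun i => hY i.succ) he
    have h2 := isLead_divDiff_zero f j (fun y => Fin.init (q y)) (Fin.init X)
      (fun y i => hX y _) hY
    have h3 := (h1.sub h2).div_const (X (Fin.last (j + 1)) - X 0)
    simp only [divDiff, hX]
    simp only [if_neg (show X (Fin.last (j + 1)) ≠ X 0 from (hne 0).symm), Fin.prod_univ_succ]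
    convert h3 using 1
    rw [sub_zero, div_div]
    congr 1
    rw [mul_comm]
    rfl

/-- The volume of the preimage of a set under a triangular affine map. -/
lemma volume_preimage_of_isLead {T : (Fin m → ℝ) → Fin m → ℝ} {e : Fin m → ℝ}
    (hT : ∀ j, IsLead (fun y => T y j) j (e j)) (he : ∀ j, 0 < e j) (S : Set (Fin m → ℝ)) :
    volume (T ⁻¹' S) = ENNReal.ofReal (∏ j, (e j)⁻¹) * volume S := by
  choose l c h1 h2 h3 using hT
  have hM : (Matrix.of l).det = ∏ j, e j := by
    rw [Matrix.det_of_isLowerTriangular]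
    · exact Finset.prod_congr rfl fun j _ => h3 j
    · exact fun i j hij => h2 i j hij
  have hpos : 0 < ∏ j, e j := Finset.prod_pos fun j _ => he j
  have hTeq : T ⁻¹' S = Matrix.toLin' (Matrix.of l) ⁻¹' ((fun v => v + c) ⁻¹' S) := by
    ext y
    have : T y = Matrix.toLin' (Matrix.of l) y + c := funext fun j => h1 j y
    simp only [Set.mem_preimage, this]
  rw [hTeq, Measure.addHaar_preimage_linearMap, measure_preimage_add_right,
    LinearMap.det_toLin', hM, abs_of_pos (inv_pos.2 hpos), Finset.prod_inv_distrib]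
  rw [LinearMap.det_toLin', hM]
  exact hpos.ne'

end IsLead

/-! ### Volume bounds -/

/-- The simplex sits inside the `ℓ¹` ball of radius `R`. The lost factor `2^m` is absorbed by the
final constant. -/
lemma volume_simplex_le {m : ℕ} (hm : m ≠ 0) {R : ℝ} (hR : 0 ≤ R) :
    volume {u : Fin m → ℝ | (∀ i, 0 ≤ u i) ∧ ∑ i, u i ≤ R} ≤
      ENNReal.ofReal ((2 * R) ^ m / m !) := by
  have : Nonempty (Fin m) := ⟨⟨0, Nat.pos_of_ne_zero hm⟩⟩
  have h := volume_sum_rpow_le (Fin m) (le_refl (1 : ℝ)) R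
  simp only [Real.rpow_one, div_one, Fintype.card_fin, Real.Gamma_nat_eq_factorial] at h
  calc volume {u : Fin m → ℝ | (∀ i, 0 ≤ u i) ∧ ∑ i, u i ≤ R}
      ≤ volume {u : Fin m → ℝ | ∑ i, |u i| ≤ R} := by
        refine measure_mono fun u hu => ?_
        rw [Set.mem_ofPred_eq, Finset.sum_congr rfl fun i _ => abs_of_nonneg (hu.1 i)]
        exact hu.2
    _ = _ := by
        rw [h, ← ENNReal.ofReal_pow hR, ← ENNReal.ofReal_mul (by positivity)]
        congr 1
        have : Real.Gamma (1 + 1) = 1 := by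
          rw [show (1 : ℝ) + 1 = 2 by norm_num, Real.Gamma_two]
        rw [this, mul_pow]
        ring

lemma volume_incSet_le {m : ℕ} (hm : m ≠ 0) {a b : ℝ} (hab : a < b) :
    volume (incSet a b m) ≤ ENNReal.ofReal ((2 * (b - a)) ^ m / m !) := by
  -- With `k = 1` the node sequence is `a, x_0, x_1, …`, so these are the successive gaps, a
  -- triangular map with unit diagonal.
  have hT : ∀ j : Fin m, IsLead (fun x : Fin m → ℝ =>
      nodesFst 1 a b x (j + 1) - nodesFst 1 a b x j) j (1 : ℝ) := fun j => by
    have h1 : IsLead (fun x : Fin m → ℝ => nodesFst 1 a b x (j + 1)) j 1 := by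
      simp only [nodesFst_add]
      exact isLead_apply
    have h2 : IsLead (fun x : Fin m → ℝ => nodesFst 1 a b x j) j 0 := by
      rcases Nat.eq_zero_or_pos j.1 with h | h
      · simp only [nodesFst_of_lt (show (j : ℕ) < 1 by omega)]
        exact isLead_const a
      · obtain ⟨i, hi⟩ : ∃ i : Fin m, (j : ℕ) = i + 1 := ⟨⟨j - 1, by omega⟩, by simp; omega⟩
        simp only [hi, nodesFst_add]
        exact isLead_apply_of_lt (Fin.lt_def.2 (by omega))
    simpa using h1.sub h2
  have h := volume_preimage_of_isLead
    (T := fun x j => nodesFst 1 a b x (j + 1) - nodesFst 1 a b x j) hT (fun _ => one_pos)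
    {u : Fin m → ℝ | (∀ i, 0 ≤ u i) ∧ ∑ i, u i ≤ b - a}
  simp only [inv_one, Finset.prod_const_one, ENNReal.ofReal_one, one_mul] at h
  refine (measure_mono fun x hx => ?_).trans
    (h.trans_le (volume_simplex_le hm (sub_pos.2 hab).le))
  refine ⟨fun j => sub_nonneg.2 (nodesFst_mono hab hx (Nat.le_succ _)), ?_⟩
  rw [Fin.sum_univ_eq_sum_range (fun i => nodesFst 1 a b x (i + 1) - nodesFst 1 a b x i) m,
    Finset.sum_range_sub, nodesFst_of_lt (i := 0) one_pos]
  have h0 : nodesFst 1 a b x m ≤ nodesFst 1 a b x (1 + m) :=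
    nodesFst_mono hab hx (by omega)
  rw [nodesFst_of_ge (i := 1 + m) le_rfl] at h0
  linarith

/-- The leading coefficient of `increment K a b p j` as a function of the `y`-coordinates of `p` is
the inverse of this product. -/
def gapProd (K : ℕ) (a b : ℝ) {m : ℕ} (x : Fin m → ℝ) (j : ℕ) : ℝ :=
  ∏ i : Fin K, (nodesFst (K + 1) a b x (j + (K + 1)) - nodesFst (K + 1) a b x (j + 1 + i))

/-- The point `p j` is the node of index `j + (K + 1)`: the last entry of the window starting at `j
+ 1`, and beyond the window starting at `j`. All other nodes involved are fixed or carry earlier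
ordinates. -/
lemma isLead_increment (K : ℕ) {a b : ℝ} (hab : a < b) {m : ℕ} {x : Fin m → ℝ}
    (hx : x ∈ incSet a b m) (j : Fin m) :
    IsLead (fun y => increment K a b (fun i => (x i, y i)) j) j (gapProd K a b x j)⁻¹ := by
  have hfst : ∀ (y : Fin m → ℝ) i, (nodes (K + 1) a b (fun i => (x i, y i)) i).1 =
      nodesFst (K + 1) a b x i := fun y i => nodes_fst i
  have hlow : ∀ i, i < j + (K + 1) →
      IsLead (fun y => (nodes (K + 1) a b (fun i => (x i, y i)) i).2) j 0 := fun i hi => by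
    rcases nodes_cases (K + 1) a b (m := m) i with ⟨_, h⟩ | ⟨i', hi', h⟩ | ⟨_, h⟩
    · simp only [h]
      exact isLead_const _
    · simp only [h]
      exact isLead_apply_of_lt (Fin.lt_def.2 (by omega))
    · simp only [h]
      exact isLead_const _
  have h1 : IsLead (fun y => windowDiff (fun x => x ^ (K + 1)) K
      (nodes (K + 1) a b fun i => (x i, y i)) (j + 1)) j (1 / gapProd K a b x j) := by
    have := isLead_divDiff (J := j) (fun x => x ^ (K + 1)) K
      (fun y (t : Fin (K + 1)) => nodes (K + 1) a b (fun i => (x i, y i)) (j + 1 + t))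
      (fun t => nodesFst (K + 1) a b x (j + 1 + t)) (fun y t => hfst y _)
      (fun t => (nodesFst_lt hab hx (by simp) (by simp) (by simp; omega)).ne)
      (fun t => hlow _ (by simp; omega)) (e := 1) (by
        have : (j : ℕ) + 1 + K = j + (K + 1) := by omega
        simp only [Fin.val_last, this, nodes_add]
        exact isLead_apply)
    have h : (j : ℕ) + 1 + K = j + (K + 1) := by omega
    simp only [Fin.val_last, Fin.val_castSucc, h] at this
    exact this
  have h2 := isLead_divDiff_zero (J := j) (fun x => x ^ (K + 1)) K
      (fun y (t : Fin (K + 1)) => nodes (K + 1) a b (fun i => (x i, y i)) (j + t))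
      (fun t => nodesFst (K + 1) a b x (j + t)) (fun y t => hfst y _)
      (fun t => hlow _ (by omega))
  have := h1.sub h2
  rwa [sub_zero, one_div] at this

lemma gapProd_pos {K : ℕ} {a b : ℝ} (hab : a < b) {m : ℕ} {x : Fin m → ℝ}
    (hx : x ∈ incSet a b m) (j : Fin m) : 0 < gapProd K a b x j :=
  Finset.prod_pos fun i _ =>
    sub_pos.2 (nodesFst_lt hab hx (by omega) (by omega) (by omega))

lemma prod_le_sum_div_pow {m : ℕ} (hm : m ≠ 0) {u : Fin m → ℝ} (hu : ∀ i, 0 ≤ u i) {S : ℝ}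
    (hS : ∑ i, u i ≤ S) : ∏ i, u i ≤ (S / m) ^ m := by
  have hm' : (0 : ℝ) < m := Nat.cast_pos.2 (Nat.pos_of_ne_zero hm)
  have h := Real.geom_mean_le_arith_mean Finset.univ (fun _ => (1 : ℝ)) u (fun _ _ => zero_le_one)
    (by simpa using Nat.pos_of_ne_zero hm) fun i _ => hu i
  simp only [Real.rpow_one, Finset.sum_const, Finset.card_univ, Fintype.card_fin, nsmul_eq_mul,
    mul_one, one_mul] at h
  have hprod : 0 ≤ ∏ i, u i := Finset.prod_nonneg fun i _ => hu i
  calc ∏ i, u i = ((∏ i, u i) ^ ((m : ℝ)⁻¹)) ^ m := (Real.rpow_inv_natCast_pow hprod hm).symm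
    _ ≤ (S / m) ^ m := pow_le_pow_left₀ (Real.rpow_nonneg hprod _)
        (h.trans (div_le_div_of_nonneg_right hS hm'.le)) _

/-- Each of the `K` factors of `gapProd` is at most `X (j + K + 1) - X j`. These spans cover each
gap between consecutive nodes at most `K + 1` times, so they sum to at most `(K + 1) (b - a)`, and
AM-GM applies. -/
lemma prod_gapProd_le {K : ℕ} {a b : ℝ} (hab : a < b) {m : ℕ} (hm : m ≠ 0) {x : Fin m → ℝ}
    (hx : x ∈ incSet a b m) :
    ∏ j : Fin m, gapProd K a b x j ≤ (((K + 1) * (b - a) / m) ^ K) ^ m := by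
  set X := nodesFst (K + 1) a b x with hXdef
  have hmono : Monotone X := nodesFst_mono hab hx
  have hXa : ∀ i, a ≤ X i := fun i => by
    have := hmono (Nat.zero_le i)
    rwa [hXdef, nodesFst_of_lt (Nat.succ_pos K), ← hXdef] at this
  have hXb : ∀ i, X i ≤ b := fun i => by
    have := hmono (show i ≤ i + (K + 1 + m) by omega)
    rwa [hXdef, nodesFst_of_ge (i := i + (K + 1 + m)) (by omega), ← hXdef] at this
  have hsum : ∑ j : Fin m, (X (j + (K + 1)) - X j) ≤ (K + 1) * (b - a) := by
    have h1 : ∀ j : Fin m, X (j + (K + 1)) - X j =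
        ∑ t ∈ Finset.range (K + 1), (X (j + t + 1) - X (j + t)) := fun j => by
      exact (Finset.sum_range_sub (fun t => X (j + t)) (K + 1)).symm
    simp only [h1]
    rw [Finset.sum_comm]
    calc _ ≤ ∑ t ∈ Finset.range (K + 1), (b - a) := Finset.sum_le_sum fun t _ => by
            rw [Fin.sum_univ_eq_sum_range (fun j => X (j + t + 1) - X (j + t)) m]
            have h2 := Finset.sum_range_sub (fun j => X (j + t)) m
            simp only [add_right_comm _ 1 t] at h2
            rw [h2]
            exact sub_le_sub (hXb _) (hXa _)
      _ = (K + 1) * (b - a) := by simp [mul_sub]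
  calc ∏ j : Fin m, gapProd K a b x j
      ≤ ∏ j : Fin m, (X (j + (K + 1)) - X j) ^ K := by
        refine Finset.prod_le_prod (fun j _ => (gapProd_pos hab hx j).le) fun j _ => ?_
        calc gapProd K a b x j ≤ ∏ _i : Fin K, (X (j + (K + 1)) - X j) :=
              Finset.prod_le_prod (fun i _ => sub_nonneg.2 (hmono (by omega)))
                fun i _ => sub_le_sub_left (hmono (by omega)) _
          _ = _ := by simp
    _ = (∏ j : Fin m, (X (j + (K + 1)) - X j)) ^ K := Finset.prod_pow _ _ _
    _ ≤ ((((K + 1) * (b - a)) / m) ^ m) ^ K :=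
        pow_le_pow_left₀ (Finset.prod_nonneg fun j _ => sub_nonneg.2 (hmono (by omega)))
          (prod_le_sum_div_pow hm (fun j => sub_nonneg.2 (hmono (by omega))) hsum) _
    _ = _ := pow_right_comm _ _ _

/-- The volume of the set of chains of length `m`. -/
lemma volume_chainSet_le (K : ℕ) {a b : ℝ} (hab : a < b) {m : ℕ} (hm : m ≠ 0) :
    volume (chainSet (K + 1) a b m) ≤
      ENNReal.ofReal ((((K + 1) * (b - a) / m) ^ K) ^ m) *
        ENNReal.ofReal ((2 * ((K + 1) * (b - a))) ^ m / m !) *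
        ENNReal.ofReal ((2 * (b - a)) ^ m / m !) := by
  set e := MeasurableEquiv.arrowProdEquivProdArrow ℝ ℝ (Fin m)
  have he := volume_measurePreserving_arrowProdEquivProdArrow ℝ ℝ (Fin m)
  set V := ENNReal.ofReal ((((K + 1) * (b - a) / m) ^ K) ^ m) *
        ENNReal.ofReal ((2 * ((K + 1) * (b - a))) ^ m / m !)
  have hmeas : MeasurableSet (e.symm ⁻¹' chainSet (K + 1) a b m) :=
    e.symm.measurable (measurableSet_chainSet (K + 1) hab m)
  -- Tonelli: abscissas outside, ordinates inside.
  rw [← (he.symm e).measure_preimage_equiv, Measure.volume_eq_prod, Measure.prod_apply hmeas]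
  have hfib : ∀ x : Fin m → ℝ, volume (Prod.mk x ⁻¹' (e.symm ⁻¹' chainSet (K + 1) a b m)) ≤
      (incSet a b m).indicator (fun _ => V) x := fun x => by
    by_cases hx : x ∈ incSet a b m
    · rw [Set.indicator_of_mem hx]
      -- The fibre over `x` lies in the preimage of a simplex under the increment map, whose
      -- determinant is `(∏ gapProd)⁻¹`.
      have h := volume_preimage_of_isLead (isLead_increment K hab hx)
        (fun j => inv_pos.2 (gapProd_pos hab hx j))
        {u : Fin m → ℝ | (∀ i, 0 ≤ u i) ∧ ∑ i, u i ≤ (K + 1) * (b - a)}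
      simp only [inv_inv] at h
      refine (measure_mono fun y hy => ?_).trans (h.trans_le (mul_le_mul'
        (ENNReal.ofReal_le_ofReal (prod_gapProd_le hab hm hx))
        (volume_simplex_le hm (mul_nonneg (by positivity) (sub_pos.2 hab).le))))
      have hy' : (fun i => (x i, y i)) ∈ chainSet (K + 1) a b m := hy
      exact ⟨fun i => increment_nonneg hab hy' (by omega), sum_increment_le hab hy'⟩
    · rw [Set.indicator_of_notMem hx, nonpos_iff_eq_zero]
      refine measure_mono_null (fun y hy => ?_) (measure_empty (μ := volume))
      have hy' : (fun i => (x i, y i)) ∈ chainSet (K + 1) a b m := hy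
      exact hx (fst_mem_incSet hy')
  refine (lintegral_mono hfib).trans ((lintegral_indicator_const_le _ _).trans ?_)
  exact mul_le_mul_right (volume_incSet_le hm hab) _


/-! ### Exponential decay of the volume for long chains -/

lemma pow_div_factorial_le {m : ℕ} (hm : m ≠ 0) {D : ℝ} (hD : 0 ≤ D) :
    D ^ m / m ! ≤ (3 * D / m) ^ m := by
  have hm' : (0 : ℝ) < m := Nat.cast_pos.2 (Nat.pos_of_ne_zero hm)
  have h1 : (m : ℝ) ^ m / m ! ≤ 3 ^ m := by
    refine (Real.pow_div_factorial_le_exp m hm'.le m).trans ?_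
    rw [← Real.exp_one_pow]
    exact pow_le_pow_left₀ (Real.exp_pos 1).le Real.exp_one_lt_three.le m
  calc D ^ m / m ! = (D / m) ^ m * ((m : ℝ) ^ m / m !) := by
        rw [div_pow]
        field_simp
    _ ≤ (D / m) ^ m * 3 ^ m := mul_le_mul_of_nonneg_left h1 (by positivity)
    _ = (3 * D / m) ^ m := by
        rw [← mul_pow]
        ring

lemma volume_chainSet_le_pow (K : ℕ) {n m : ℕ} (hn : 1 ≤ n)
    (hm : 72 * (K + 1) ^ (K + 1) * n < m) :
    volume (chainSet (K + 1) 0 (n : ℝ) m) ≤ ENNReal.ofReal ((1 / 2) ^ m) := by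
  have hm0 : m ≠ 0 := by omega
  have hn' : (0 : ℝ) < n := Nat.cast_pos.2 hn
  have hm' : (0 : ℝ) < m := Nat.cast_pos.2 (Nat.pos_of_ne_zero hm0)
  set r : ℝ := n / m with hr
  have hr0 : 0 < r := div_pos hn' hm'
  -- The base of the final power is `36 (K + 1)^(K + 1) r²`, with `36 = (3 · 2)²` from the two
  -- simplex bounds. Doubling `36` makes one factor `r` bring it below `1/2`; the other is only
  -- bounded by `1`, as is the factor `r^K` from the product of gaps.
  have hrC : 72 * ((K : ℝ) + 1) ^ (K + 1) * r ≤ 1 := by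
    rw [hr, mul_div_assoc', div_le_one hm']
    exact_mod_cast hm.le
  have hone : (1 : ℝ) ≤ ((K : ℝ) + 1) ^ (K + 1) :=
    one_le_pow₀ (by linarith [Nat.cast_nonneg (α := ℝ) K])
  have hr1 : r ≤ 1 := by nlinarith
  have h1 : ((((K : ℝ) + 1) * n / m) ^ K) ^ m ≤ (((K : ℝ) + 1) ^ K) ^ m := by
    refine pow_le_pow_left₀ (by positivity) (pow_le_pow_left₀ (by positivity) ?_ _) _
    rw [mul_div_assoc]
    exact mul_le_of_le_one_right (by positivity) hr1
  have h2 := pow_div_factorial_le hm0 (D := 2 * (((K : ℝ) + 1) * n)) (by positivity)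
  have h3 := pow_div_factorial_le hm0 (D := 2 * (n : ℝ)) (by positivity)
  refine (volume_chainSet_le K (Nat.cast_pos.2 hn) hm0).trans ?_
  simp only [sub_zero]
  rw [← ENNReal.ofReal_mul (by positivity), ← ENNReal.ofReal_mul (by positivity)]
  refine ENNReal.ofReal_le_ofReal ?_
  calc _ ≤ (((K : ℝ) + 1) ^ K) ^ m * (3 * (2 * (((K : ℝ) + 1) * n)) / m) ^ m *
        (3 * (2 * (n : ℝ)) / m) ^ m := by gcongr
    _ = (36 * ((K : ℝ) + 1) ^ (K + 1) * r * r) ^ m := by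
        rw [← mul_pow, ← mul_pow, hr]
        congr 1
        field_simp
        ring
    _ ≤ (1 / 2) ^ m := by
        refine pow_le_pow_left₀ (by positivity) ?_ _
        nlinarith

/-! ### From the tail bound to the expectation -/

section Poisson

variable {Ω : Type*} [MeasurableSpace Ω] {P : Measure Ω} {Pi : Ω → Set (ℝ × ℝ)}

lemma toENNReal_maxLength (k : ℕ) (a b : ℝ) (S : Set (ℝ × ℝ)) :
    (maxLength k a b S : ℝ≥0∞) =
      ⨆ (m : ℕ) (_ : ∃ p : Fin m → ℝ × ℝ, IsMonotoneChain k a b S p), (m : ℝ≥0∞) := by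
  simp only [maxLength, ENat.toENNReal_iSup, ENat.toENNReal_coe]

lemma IsPoissonProcess.measurable_maxLength (h : IsPoissonProcess P Pi) (k : ℕ) {a b : ℝ}
    (hab : a < b) : Measurable fun ω => (maxLength k a b (Pi ω) : ℝ≥0∞) := by
  simp only [toENNReal_maxLength]
  refine Measurable.iSup fun m => ?_
  have : (fun ω => ⨆ _ : ∃ p : Fin m → ℝ × ℝ, IsMonotoneChain k a b (Pi ω) p, (m : ℝ≥0∞)) =
      {ω | ∃ p : Fin m → ℝ × ℝ, IsMonotoneChain k a b (Pi ω) p}.indicator fun _ => (m : ℝ≥0∞) := by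
    funext ω
    by_cases hω : ∃ p : Fin m → ℝ × ℝ, IsMonotoneChain k a b (Pi ω) p
    · rw [Set.indicator_of_mem (by exact hω), iSup_pos hω]
    · rw [Set.indicator_of_notMem (by exact hω), iSup_neg hω, bot_eq_zero]
  rw [this]
  exact measurable_const.indicator (h.measurableSet_exists_isMonotoneChain k hab m)

lemma IsPoissonProcess.lintegral_maxLength_le [IsProbabilityMeasure P]
    (h : IsPoissonProcess P Pi) (K : ℕ) {n : ℕ} (hn : 1 ≤ n) :
    ∫⁻ ω, (maxLength (K + 1) 0 (n : ℝ) (Pi ω) : ℝ≥0∞) ∂P ≤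
      ((72 * (K + 1) ^ (K + 1) * n : ℕ) : ℝ≥0∞) + 2 := by
  set N := 72 * (K + 1) ^ (K + 1) * n
  have hn' : (0 : ℝ) < n := Nat.cast_pos.2 hn
  set E : ℕ → Set Ω := fun m =>
    {ω | N < m ∧ ∃ p : Fin m → ℝ × ℝ, IsMonotoneChain (K + 1) 0 (n : ℝ) (Pi ω) p}
  have hE : ∀ m, MeasurableSet (E m) := fun m =>
    (MeasurableSet.const _).inter (h.measurableSet_exists_isMonotoneChain (K + 1) hn' m)
  have hPE : ∀ m, P (E m) ≤ ENNReal.ofReal ((1 / 2) ^ m) := fun m => by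
    by_cases hm : N < m
    · exact (measure_mono fun ω hω => hω.2).trans
        ((h.measure_exists_isMonotoneChain_le (K + 1) hn' m).trans (volume_chainSet_le_pow K hn hm))
    · have : E m = ∅ := Set.eq_empty_of_forall_notMem fun ω hω => hm hω.1
      rw [this, measure_empty]
      exact zero_le
  calc ∫⁻ ω, (maxLength (K + 1) 0 (n : ℝ) (Pi ω) : ℝ≥0∞) ∂P
      -- Any chain length attained is either at most `N` or one of the terms of the series, so the
      -- supremum is below the sum.
      ≤ ∫⁻ ω, ((N : ℝ≥0∞) + ∑' m, (E m).indicator (fun _ => (m : ℝ≥0∞)) ω) ∂P := by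
        refine lintegral_mono fun ω => ?_
        dsimp only
        rw [toENNReal_maxLength]
        refine iSup₂_le fun m hm => ?_
        rcases le_or_gt m N with hmN | hmN
        · exact le_add_right (Nat.cast_le.2 hmN)
        · refine le_add_left (le_trans ?_ (ENNReal.le_tsum m))
          rw [Set.indicator_of_mem (by exact ⟨hmN, hm⟩)]
    _ = N + ∑' m : ℕ, (m : ℝ≥0∞) * P (E m) := by
        rw [lintegral_add_left measurable_const, lintegral_const, measure_univ, mul_one,
          lintegral_tsum fun m => (measurable_const.indicator (hE m)).aemeasurable]
        simp only [lintegral_indicator_const (hE _)]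
    _ ≤ N + ∑' m : ℕ, ENNReal.ofReal (m * (1 / 2) ^ m) := by
        gcongr with m
        rw [ENNReal.ofReal_mul (Nat.cast_nonneg m), ENNReal.ofReal_natCast]
        gcongr
        exact hPE m
    _ = N + 2 := by
        have hs : HasSum (fun m : ℕ => (m : ℝ) * (1 / 2) ^ m) (1 / 2 / (1 - 1 / 2) ^ 2) :=
          hasSum_coe_mul_geometric_of_norm_lt_one (by norm_num)
        rw [← ENNReal.ofReal_tsum_of_nonneg (fun m => by positivity) hs.summable, hs.tsum_eq]
        norm_num

end Poisson

end KMonotone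

theorem mainTheorem6 (k : ℕ) (hk : 1 ≤ k) :
    ∃ c : ℝ, ∀ (Ω : Type*) [MeasurableSpace Ω] (P : Measure Ω) [IsProbabilityMeasure P]
      (Pi : Ω → Set (ℝ × ℝ)), KMonotone.IsPoissonProcess P Pi → ∀ n : ℕ, 1 ≤ n →
        AEMeasurable (fun ω => (KMonotone.maxLength k 0 (n : ℝ) (Pi ω) : ℝ≥0∞)) P ∧
          ∫⁻ ω, (KMonotone.maxLength k 0 (n : ℝ) (Pi ω) : ℝ≥0∞) ∂P < ENNReal.ofReal (c * n) := by
  obtain ⟨K, rfl⟩ : ∃ K, k = K + 1 := ⟨k - 1, by omega⟩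
  -- The expectation is at most `72 (K + 1)^(K + 1) n + 2`, and `2 < 3 n` gives the strict
  -- inequality.
  refine ⟨((72 * (K + 1) ^ (K + 1) + 3 : ℕ) : ℝ), fun Ω _ P _ Pi h n hn => ⟨?_, ?_⟩⟩
  · exact (h.measurable_maxLength (K + 1) (Nat.cast_pos.2 hn)).aemeasurable
  · refine (h.lintegral_maxLength_le K hn).trans_lt ?_
    rw [← Nat.cast_mul, ENNReal.ofReal_natCast]
    norm_cast
    rw [add_mul]
    omega
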